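/- Let $R$ be a commutative ring and let $H$ be a Hopf algebra over $R$, with counit $\varepsilon$, comultiplication $\Delta$ and antipode $\mathcal S$, that is finitely generated projective as an $R$-module. Assume that $H$ is separable over $R$ and involutory ($\mathcal S^2=1$). Let $\int_H$ be the $R$-module of two-sided integrals of $H$, that is, of all $t\in H$ with $at=ta=\varepsilon(a)t$ for all $a\in H$, and let $\Lambda\in\int_H$ be a generating integral: $\int_H=R\Lambda$. Let $S\subseteq R$ be a subring and suppose that $(H,\Lambda)$ has a weak $S$-form, that is, there is an $S$-subalgebra $B\subseteq H$ which is finitely generated as an $S$-module and such that $\sum \mathcal S(\Lambda_1)\otimes\Lambda_2$ lies in the image of $B\otimes_S B$ in $H\otimes_R H$, where $\Delta(\Lambda)=\sum\Lambda_1\otimes\Lambda_2$. Let $M$ be a left $H$-module that is finitely generated projective over $R$ and satisfies $\operatorname{End}_H(M)\cong R$ as $R$-algebras. Write $\operatorname{Tr}\colon\operatorname{End}_R(M)\cong M\otimes_R\operatorname{Hom}_R(M,R)\to R$ for the trace (evaluation), $\chi_M(a)=\operatorname{Tr}(m\mapsto am)$ for the character of $M$, and $\operatorname{rank}_R M=\operatorname{Tr}(1_M)\in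 R$ for its Hattori–Stallings rank. Then there is a two-sided integral $\lambda$ of the dual algebra $H^\vee=\operatorname{Hom}_R(H,R)$ (with convolution product and augmentation $f\mapsto f(1)$) with $\lambda(\Lambda)=1$; it is the only left integral of $H^\vee$ with this property, and $\beta(a,b)=\lambda(ab)$ is a nonsingular associative symmetric bilinear form on $H$. Moreover, $\operatorname{rank}_R M$ is a unit of $R$, and the index $$[H:M]_\beta=\varepsilon(\Lambda)\,(\operatorname{rank}_R M)^{-1}$$ is integral over $S$. Here $[H:M]_\beta\in R$ is the scalar by which the central element $z\in H$ determined by $\chi_M=\beta(\,\cdot\,,z)$ acts on $M$. (This is Rumynin's generalization of Frobenius' divisibility theorem.) -/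

import Mathlib

open scoped TensorProduct

universe u v w

namespace HopfIndex

section Trace

variable (R : Type u) [CommRing R] (M : Type w) [AddCommGroup M] [Module R M]
  [Module.Finite R M] [Module.Projective R M]

/-- The trace `End_R(M) ≅ M^∨ ⊗ M → R` of a finitely generated projective module, given by
evaluation. (`LinearMap.trace` is only meaningful for free modules.) -/
noncomputable def trace : Module.End R M →ₗ[R] R :=
  contractLeft R M ∘ₗ (dualTensorHomEquiv R M M).symm.toLinearMap

/-- The Hattori-Stallings rank `Tr(1_M)` of a finitely generated projective module. -/
noncomputable def rank : R := trace R M 1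

theorem trace_mul_comm (f g : Module.End R M) : trace R M (f * g) = trace R M (g * f) := by
  have key : ∀ (p q : Module.Dual R M ⊗[R] M),
      trace R M (dualTensorHom R M M p * dualTensorHom R M M q) =
        trace R M (dualTensorHom R M M q * dualTensorHom R M M p) := by
    intro p q
    have hmul : ∀ (a b : Module.Dual R M) (m n : M),
        dualTensorHom R M M (a ⊗ₜ m) * dualTensorHom R M M (b ⊗ₜ n) =
          a n • dualTensorHom R M M (b ⊗ₜ m) := by
      intro a b m n
      ext x
      simp [smul_smul, mul_comm]
    have htr : ∀ (b : Module.Dual R M) (m : M),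
        trace R M (dualTensorHom R M M (b ⊗ₜ m)) = b m := by
      intro b m
      have h : dualTensorHom R M M (b ⊗ₜ m) = dualTensorHomEquiv R M M (b ⊗ₜ m) := rfl
      rw [h]
      simp [trace]
    induction p with
    | zero => simp
    | add p₁ p₂ h₁ h₂ => simp only [map_add, add_mul, mul_add, h₁, h₂]
    | tmul a m =>
      induction q with
      | zero => simp
      | add q₁ q₂ h₁ h₂ => simp only [map_add, add_mul, mul_add, h₁, h₂]
      | tmul b n =>
        rw [hmul, hmul, map_smul, map_smul, htr, htr, smul_eq_mul, smul_eq_mul, mul_comm]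
  have h := key ((dualTensorHomEquiv R M M).symm f) ((dualTensorHomEquiv R M M).symm g)
  have e : ∀ f : Module.End R M,
      dualTensorHom R M M ((dualTensorHomEquiv R M M).symm f) = f :=
    fun f => (dualTensorHomEquiv R M M).apply_symm_apply f
  rwa [e, e] at h

end Trace

section Algebras

variable (R : Type u) [CommRing R] (A : Type v) [Ring A] [Algebra R A]

/-- An `R`-algebra `A` is separable if it is projective as a module over its enveloping algebra
`A ⊗ Aᵐᵒᵖ`, which acts on `A` by `(a ⊗ b) • x = a * x * b`. -/
def IsSeparableAlgebra : Prop :=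
  letI : Module (A ⊗[R] Aᵐᵒᵖ) A := instModuleTensorProductMop R A
  Module.Projective (A ⊗[R] Aᵐᵒᵖ) A

variable {R A}

/-- Left integrals of an augmented algebra: `a * t = ε(a) t` for all `a`. -/
def leftIntegrals (ε : A →ₐ[R] R) : Submodule R A where
  carrier := {t | ∀ a, a * t = ε a • t}
  add_mem' {s t} hs ht a := by rw [mul_add, hs a, ht a, smul_add]
  zero_mem' a := by simp
  smul_mem' r t ht a := by rw [mul_smul_comm, ht a, smul_comm]

/-- Right integrals of an augmented algebra: `t * a = ε(a) t` for all `a`. -/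
def rightIntegrals (ε : A →ₐ[R] R) : Submodule R A where
  carrier := {t | ∀ a, t * a = ε a • t}
  add_mem' {s t} hs ht a := by rw [add_mul, hs a, ht a, smul_add]
  zero_mem' a := by simp
  smul_mem' r t ht a := by rw [smul_mul_assoc, ht a, smul_comm]

/-- Two-sided integrals of an augmented algebra. -/
def integrals (ε : A →ₐ[R] R) : Submodule R A := leftIntegrals ε ⊓ rightIntegrals ε

/-- A nonsingular associative symmetric bilinear form on `A`. By symmetry, bijectivity of
`a ↦ β(·, a)` is the same as bijectivity of `a ↦ β(a, ·)`. -/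
structure IsSymmetrizing (β : LinearMap.BilinForm R A) : Prop where
  assoc : ∀ x y z, β (x * y) z = β x (y * z)
  symm : ∀ x y, β x y = β y x
  nonsingular : Function.Bijective β.flip

variable (R A) (M : Type w) [AddCommGroup M] [Module R M] [Module A M] [IsScalarTower R A M]

/-- The central character `ω_M : Z(A) → R` of a module `M` with `End_A(M) ≅ R`; the element
`x` of the centre acts on `M` as multiplication by `ω_M(x)`. -/
def centralCharacter (e : Module.End A M ≃ₐ[R] R) : Subalgebra.center R A →ₐ[R] R :=
  e.toAlgHom.comp
    { toFun := fun x =>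
        { toFun := fun m => (x : A) • m
          map_add' := smul_add _
          map_smul' := fun a m => by
            have h : a * (x : A) = (x : A) * a := Subalgebra.mem_center_iff.mp x.2 a
            rw [RingHom.id_apply, ← mul_smul, ← mul_smul, h] }
      map_one' := by ext m; simp
      map_mul' := fun x y => LinearMap.ext fun m => mul_smul (x : A) (y : A) m
      map_zero' := by ext m; simp
      map_add' := fun x y => by ext m; simp [add_smul]
      commutes' := fun r => by ext m; simp }

variable [Module.Finite R M] [Module.Projective R M]

/-- The character `χ_M(a) = Tr(a_M)` of `M`. -/
noncomputable def character : A →ₗ[R] R :=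
  trace R M ∘ₗ (Algebra.lsmul R R M : A →ₐ[R] Module.End R M).toLinearMap

theorem character_mul_comm (a b : A) : character R A M (a * b) = character R A M (b * a) := by
  simp only [character, LinearMap.comp_apply, AlgHom.toLinearMap_apply, map_mul]
  exact trace_mul_comm R M _ _

variable {R A}

/-- The element `z_β(M)` of `A` determined by `χ_M = β(·, z_β(M))`. -/
noncomputable def characterElement {β : LinearMap.BilinForm R A} (hβ : IsSymmetrizing β) : A :=
  (LinearEquiv.ofBijective β.flip hβ.nonsingular).symm (character R A M)

theorem form_characterElement {β : LinearMap.BilinForm R A} (hβ : IsSymmetrizing β) (a : A) :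
    β a (characterElement M hβ) = character R A M a :=
  LinearMap.congr_fun
    ((LinearEquiv.ofBijective β.flip hβ.nonsingular).apply_symm_apply (character R A M)) a

theorem characterElement_mem_center {β : LinearMap.BilinForm R A} (hβ : IsSymmetrizing β) :
    characterElement M hβ ∈ Subalgebra.center R A := by
  refine Subalgebra.mem_center_iff.mpr fun x => hβ.nonsingular.1 (LinearMap.ext fun a => ?_)
  change β a (x * characterElement M hβ) = β a (characterElement M hβ * x)
  rw [← hβ.assoc, form_characterElement, character_mul_comm, ← form_characterElement M hβ,
    hβ.assoc, hβ.symm, hβ.assoc]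

/-- The index (Schur element) `[A : M]_β = ω_M(z_β(M))`. -/
noncomputable def index {β : LinearMap.BilinForm R A} (hβ : IsSymmetrizing β)
    (e : Module.End A M ≃ₐ[R] R) : R :=
  centralCharacter R A M e ⟨characterElement M hβ, characterElement_mem_center M hβ⟩

end Algebras

section Hopf

variable (R : Type u) [CommRing R] (H : Type v) [Ring H] [HopfAlgebra R H]

/-- The dual algebra `H^∨ = Hom_R(H, R)` with the convolution product
`(f * g)(a) = ∑ f(a₁) g(a₂)`. -/
abbrev DualAlgebra : Type (max u v) := WithConv (H →ₗ[R] R)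

/-- The counit `f ↦ f(1)` of `H^∨`. -/
def dualCounit : DualAlgebra R H →ₐ[R] R where
  toFun f := f.ofConv 1
  map_one' := by simp [LinearMap.convOne_def]
  map_mul' f g := by simp [LinearMap.convMul_def, Algebra.TensorProduct.one_def]
  map_zero' := by simp
  map_add' f g := by simp
  commutes' r := by simp [Algebra.algebraMap_eq_smul_one, LinearMap.convOne_def]

/-- `H` is involutory if its antipode squares to the identity. -/
def IsInvolutory : Prop :=
  ∀ a : H, HopfAlgebra.antipode R (HopfAlgebra.antipode R a) = a

variable {R H}

/-- The bilinear form `β(a, b) = ⟨f, a b⟩`. -/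
def dualForm (f : DualAlgebra R H) : LinearMap.BilinForm R H :=
  (LinearMap.mul R H).compr₂ f.ofConv

/-- `B` is a weak `S`-form of `(H, Λ)`: it is an `S`-subalgebra of `H` that is finitely generated
as an `S`-module, and `∑ 𝒮(Λ₁) ⊗ Λ₂` lies in the image of `B ⊗_S B` in `H ⊗_R H`. -/
structure IsWeakForm (S : Subring R) (Λ : H) (B : Subalgebra S H) : Prop where
  finite : Module.Finite S B
  casimir_mem :
    (HopfAlgebra.antipode R (A := H)).rTensor H (Coalgebra.comul (R := R) Λ) ∈
      LinearMap.range
        (TensorProduct.mapOfCompatibleSMul R S S H H ∘ₗ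
          TensorProduct.map B.val.toLinearMap B.val.toLinearMap)

end Hopf

end HopfIndex

/-! Separability yields an integral of augmentation 1; it is a multiple of `Λ`, so `ε(Λ)` is a unit.
Since `𝒮² = 1`, the character `χ` of the regular module is a two-sided integral of `H^∨`, and `χ(Λ)
= ε(Λ)`; hence `λ = ε(Λ)⁻¹ χ`, which is symmetric because it is a trace.

Everything else comes from the Casimir element `c = ∑ 𝒮(Λ₁) ⊗ Λ₂`, which satisfies `(1 ⊗ a) c = c (a
⊗ 1)` and `c (1 ⊗ a) = (a ⊗ 1) c`. Contracted with `λ`, these relations show that the legs of `c`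
are dual bases for `β`, whence nonsingularity and uniqueness. Writing `c = ∑ x ⊗ y`, the first
relation makes `∑ y φ x` an `H`-endomorphism of `M` for each `φ`, hence a scalar. Taking traces,
with some `φ` of trace 1, shows that the rank divides `ε(Λ)`, so it is a unit, and that the scalar
is `ω Tr(φ)` with `ω = ε(Λ) / rank M`; this `ω` is the index.

Finally `c` acts on `M ⊗ M` as `ω` times the flip, so `c²` acts as `ω²`. The weak form puts `c` in
the image of an algebra finite over `S`, so `ω²`, and then `ω`, is integral over `S`. -/

namespace HopfIndex

/-! ### Dual bases and the trace of a finitely generated projective module -/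

section Trace

variable {R : Type u} [CommRing R] {M : Type w} [AddCommGroup M] [Module R M]
  [Module.Finite R M] [Module.Projective R M]

variable (R M) in
theorem exists_dualBasis :
    ∃ s : Finset (Module.Dual R M × M), ∀ m : M, ∑ p ∈ s, p.1 m • p.2 = m := by
  obtain ⟨s, hs⟩ := TensorProduct.exists_finset ((dualTensorHomEquiv R M M).symm 1)
  refine ⟨s, fun m => ?_⟩
  have h := congrArg (dualTensorHomEquiv R M M) hs
  rw [LinearEquiv.apply_symm_apply] at h
  have h' := LinearMap.congr_fun h m
  simpa using h'.symm

theorem trace_smulRight (f : Module.Dual R M) (m : M) : trace R M (f.smulRight m) = f m := by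
  have h : f.smulRight m = dualTensorHomEquiv R M M (f ⊗ₜ m) := by ext; simp
  rw [h]
  simp [trace]

theorem trace_eq_sum {s : Finset (Module.Dual R M × M)}
    (hs : ∀ m : M, ∑ p ∈ s, p.1 m • p.2 = m) (f : Module.End R M) :
    trace R M f = ∑ p ∈ s, p.1 (f p.2) := by
  have h : f = ∑ p ∈ s, p.1.smulRight (f p.2) := by
    ext m
    conv_lhs => rw [← hs m]
    simp
  conv_lhs => rw [h]
  rw [map_sum]
  exact Finset.sum_congr rfl fun p _ => trace_smulRight _ _

-- The trace values form an ideal `J` with `M = J M`, by a dual basis. Nakayama gives `r ≡ 1 mod J`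
-- annihilating `M`; faithfulness forces `r = 0`, so `1 ∈ J`.
variable (M) in
theorem exists_trace_eq_one (hM : ∀ r : R, (∀ m : M, r • m = 0) → r = 0) :
    ∃ f : Module.End R M, trace R M f = 1 := by
  obtain ⟨s, hs⟩ := exists_dualBasis R M
  let J : Ideal R := LinearMap.range (trace R M)
  have hJ : (⊤ : Submodule R M) ≤ J • ⊤ := fun m _ => by
    rw [← hs m]
    exact Submodule.sum_mem _ fun p _ => Submodule.smul_mem_smul
      ⟨p.1.smulRight m, trace_smulRight _ _⟩ trivial
  obtain ⟨r, hr, hr0⟩ := Submodule.exists_sub_one_mem_and_smul_eq_zero_of_fg_of_le_smul J ⊤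
    Module.Finite.fg_top hJ
  rw [hM r fun m => hr0 m trivial, zero_sub, neg_mem_iff] at hr
  exact hr

end Trace

/-! ### Separability elements and normalized integrals -/

section Separable

variable {R : Type u} [CommRing R] {A : Type v} [Ring A] [Algebra R A]

/-- Projectivity splits the bimodule map `A ⊗ Aᵐᵒᵖ → A`; the element is the image of 1 under a
section, and both sides of the commutation rule are the image of `a`. -/
theorem IsSeparableAlgebra.exists_separabilityElement (h : IsSeparableAlgebra R A) :
    ∃ z : A ⊗[R] Aᵐᵒᵖ, (∀ a : A, (a ⊗ₜ 1) * z = (1 ⊗ₜ MulOpposite.op a) * z) ∧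
      LinearMap.mul' R A ((MulOpposite.opLinearEquiv R).symm.toLinearMap.lTensor A z) = 1 := by
  let _ : Module (A ⊗[R] Aᵐᵒᵖ) A := instModuleTensorProductMop R A
  have hsmul : ∀ (a b x : A), (a ⊗ₜ[R] MulOpposite.op b) • x = a * x * b := fun a b x => by
    rw [TensorProduct.Algebra.smul_def]
    simp [mul_assoc]
  have : Module.Projective (A ⊗[R] Aᵐᵒᵖ) A := h
  obtain ⟨s, hs⟩ := Module.projective_lifting_property
    (LinearMap.toSpanSingleton (A ⊗[R] Aᵐᵒᵖ) A 1) LinearMap.id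
    (fun a => ⟨a ⊗ₜ MulOpposite.op 1, by simp only [LinearMap.toSpanSingleton_apply, hsmul, mul_one]⟩)
  refine ⟨s 1, fun a => ?_, ?_⟩
  · have h1 := s.map_smul (a ⊗ₜ MulOpposite.op 1) 1
    have h2 := s.map_smul (1 ⊗ₜ MulOpposite.op a) 1
    rw [hsmul] at h1 h2
    simp only [one_mul, mul_one, smul_eq_mul] at h1 h2
    exact h1.symm.trans h2
  · have h1 := LinearMap.congr_fun hs 1
    simp only [LinearMap.comp_apply, LinearMap.toSpanSingleton_apply, LinearMap.id_apply] at h1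
    rw [← h1, h1]
    -- Only the 1 on the right becomes `s 1 • 1`, so that `s 1` can be generalized to an arbitrary
    -- tensor.
    conv_rhs => rw [← h1]
    generalize s 1 = z
    induction z with
    | zero =>
      rw [map_zero, map_zero]
      exact (zero_smul (A ⊗[R] Aᵐᵒᵖ) (1 : A)).symm
    | add x y hx hy => simp only [map_add, add_smul, hx, hy]
    | tmul a b =>
      rw [← MulOpposite.op_unop b, hsmul]
      simp

/-- Applying `ε` to the second leg of a separability element gives a left integral `f z`, to the
first leg a right integral `g z`, both of augmentation 1. Evaluating `g z * f z` in two ways shows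
that they coincide. -/
theorem IsSeparableAlgebra.exists_integral (h : IsSeparableAlgebra R A) (ε : A →ₐ[R] R) :
    ∃ t ∈ integrals ε, ε t = 1 := by
  obtain ⟨z, hz, hz1⟩ := h.exists_separabilityElement
  let ι : Aᵐᵒᵖ →ₗ[R] A := (MulOpposite.opLinearEquiv R).symm.toLinearMap
  let f : A ⊗[R] Aᵐᵒᵖ →ₗ[R] A := TensorProduct.rid R A ∘ₗ (ε.toLinearMap ∘ₗ ι).lTensor A
  let g : A ⊗[R] Aᵐᵒᵖ →ₗ[R] A :=
    TensorProduct.lid R A ∘ₗ TensorProduct.map ε.toLinearMap ι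
  have hι : ∀ b : Aᵐᵒᵖ, ι b = b.unop := fun _ => rfl
  have hf : ∀ (a : A) (b : Aᵐᵒᵖ), f (a ⊗ₜ b) = ε b.unop • a := fun a b => by simp [f, hι]
  have hg : ∀ (a : A) (b : Aᵐᵒᵖ), g (a ⊗ₜ b) = ε a • b.unop := fun a b => by simp [g, hι]
  have key : ∀ (a : A) (y : A ⊗[R] Aᵐᵒᵖ),
      f ((a ⊗ₜ 1) * y) = a * f y ∧ f ((1 ⊗ₜ MulOpposite.op a) * y) = ε a • f y ∧
      g ((a ⊗ₜ 1) * y) = ε a • g y ∧ g ((1 ⊗ₜ MulOpposite.op a) * y) = g y * a ∧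
      ε (f y) = ε (LinearMap.mul' R A (ι.lTensor A y)) ∧
      ε (g y) = ε (LinearMap.mul' R A (ι.lTensor A y)) := by
    intro a y
    induction y with
    | zero => simp
    | add x y hx hy => simp only [mul_add, add_mul, map_add, smul_add, hx, hy, and_self]
    | tmul x y => simp [hf, hg, hι, smul_smul, mul_comm]
  have h1 : ∀ a, a * f z = ε a • f z := fun a => by
    rw [← (key a z).1, hz, (key a z).2.1]
  have h2 : ∀ a, g z * a = ε a • g z := fun a => by
    rw [← (key a z).2.2.2.1, ← hz, (key a z).2.2.1]
  have h3 : ε (f z) = 1 := by rw [(key 1 z).2.2.2.2.1, hz1, map_one]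
  have h4 : ε (g z) = 1 := by rw [(key 1 z).2.2.2.2.2, hz1, map_one]
  have h5 : f z = g z := by
    have := (h1 (g z)).symm.trans (h2 (f z))
    rwa [h3, h4, one_smul, one_smul] at this
  refine ⟨f z, ⟨h1, fun a => ?_⟩, h3⟩
  rw [h5]
  exact h2 a

end Separable

/-! ### Antipode identities and the Casimir element -/

section Casimir

open HopfAlgebra Coalgebra

variable {R : Type u} [CommRing R] {H : Type v} [Ring H] [HopfAlgebra R H]

/-- Applying the antipode to `∑ x₁ 𝒮(x₂) = ε(x)` gives `∑ 𝒮²(x₂) 𝒮(x₁) = ε(x)`, and `𝒮² = 1`. -/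
theorem IsInvolutory.lift_mul_antipode_flip (hinv : IsInvolutory R H) (x : H) :
    TensorProduct.lift ((LinearMap.mul R H).flip ∘ₗ antipode R) (comul x) =
      counit (R := R) x • 1 := by
  have h := congrArg (antipode R) (sum_mul_antipode_eq_smul (ℛ R x))
  rw [← (ℛ R x).eq]
  simpa [map_sum, antipode_mul_antidistrib, hinv _] using h

theorem lift_mul_antipode (x : H) :
    TensorProduct.lift ((LinearMap.mul R H).compl₂ (antipode R)) (comul x) =
      counit (R := R) x • 1 := by
  have h := sum_mul_antipode_eq_smul (ℛ R x)
  rw [← (ℛ R x).eq]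
  simpa [map_sum] using h

theorem lift_antipode_mul (x : H) :
    TensorProduct.lift (LinearMap.mul R H ∘ₗ antipode R) (comul x) =
      counit (R := R) x • 1 := by
  have h := sum_antipode_mul_eq_smul (ℛ R x)
  rw [← (ℛ R x).eq]
  simpa [map_sum] using h

/-- In Sweedler notation `∑ T(x₁, x₂) ⊗ x₃ = 1 ⊗ x`, by coassociativity and the counit. Leaving `T`
free covers `𝒮(a) b`, `a 𝒮(b)` and, in the involutory case, `b 𝒮(a)`. -/
theorem sum_rTensor_comul (T : H →ₗ[R] H →ₗ[R] H)
    (hT : ∀ x, TensorProduct.lift T (comul x) = counit (R := R) x • 1) (x : H) :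
    ∑ i ∈ (ℛ R x).index, (T ((ℛ R x).left i)).rTensor H (comul ((ℛ R x).right i)) =
      1 ⊗ₜ[R] x := by
  have key : ∀ (l : H) (t : H ⊗[R] H), (T l).rTensor H t =
      (TensorProduct.lift T).rTensor H ((TensorProduct.assoc R H H H).symm (l ⊗ₜ t)) := by
    intro l t
    induction t with
    | zero => simp
    | add a b ha hb => simp only [map_add, TensorProduct.tmul_add, ha, hb]
    | tmul a b => simp
  have h : ∑ i ∈ (ℛ R x).index, (ℛ R x).left i ⊗ₜ[R] comul (R := R) ((ℛ R x).right i) =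
      comul.lTensor H (comul x) := by
    conv_rhs => rw [← (ℛ R x).eq]
    simp [map_sum]
  simp only [key]
  rw [← map_sum, ← map_sum, h, coassoc_symm_apply, ← LinearMap.comp_apply,
    ← LinearMap.rTensor_comp]
  have h2 : TensorProduct.lift T ∘ₗ comul = LinearMap.toSpanSingleton R H 1 ∘ₗ counit := by
    ext y
    simp [hT]
  rw [h2, LinearMap.rTensor_comp, LinearMap.comp_apply, rTensor_counit_comul]
  simp

theorem sum_lTensor_comul (T : H →ₗ[R] H →ₗ[R] H)
    (hT : ∀ x, TensorProduct.lift T (comul x) = counit (R := R) x • 1) (x : H) :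
    ∑ i ∈ (ℛ R x).index, (T.flip ((ℛ R x).right i)).lTensor H (comul ((ℛ R x).left i)) =
      x ⊗ₜ[R] 1 := by
  have key : ∀ (l : H) (t : H ⊗[R] H), (T.flip l).lTensor H t =
      (TensorProduct.lift T).lTensor H (TensorProduct.assoc R H H H (t ⊗ₜ l)) := by
    intro l t
    induction t with
    | zero => simp
    | add a b ha hb => simp only [map_add, TensorProduct.add_tmul, ha, hb]
    | tmul a b => simp
  have h : ∑ i ∈ (ℛ R x).index, comul (R := R) ((ℛ R x).left i) ⊗ₜ[R] (ℛ R x).right i =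
      comul.rTensor H (comul x) := by
    conv_rhs => rw [← (ℛ R x).eq]
    simp [map_sum]
  simp only [key]
  rw [← map_sum, ← map_sum, h, coassoc_apply, ← LinearMap.comp_apply,
    ← LinearMap.lTensor_comp]
  have h2 : TensorProduct.lift T ∘ₗ comul = LinearMap.toSpanSingleton R H 1 ∘ₗ counit := by
    ext y
    simp [hT]
  rw [h2, LinearMap.lTensor_comp, LinearMap.comp_apply, lTensor_counit_comul]
  simp

variable (R) in
/-- The Casimir element `∑ 𝒮(Λ₁) ⊗ Λ₂`. -/
noncomputable def casimir (Λ : H) : H ⊗[R] H := (antipode R (A := H)).rTensor H (comul Λ)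

theorem mul'_casimir (Λ : H) :
    LinearMap.mul' R H (casimir R Λ) = algebraMap R H (counit Λ) :=
  mul_antipode_rTensor_comul_apply Λ

/-- Write `1 ⊗ a = ∑ (𝒮(a₁) ⊗ 1) Δ(a₂)` and absorb `Δ(a₂) Δ(Λ) = ε(a₂) Δ(Λ)`. -/
theorem one_tmul_mul_comul {Λ : H} (hΛ : Λ ∈ leftIntegrals (Bialgebra.counitAlgHom R H)) (a : H) :
    (1 ⊗ₜ[R] a) * comul Λ = (antipode R a ⊗ₜ[R] 1) * comul Λ := by
  have key : ∀ (l : H) (t : H ⊗[R] H),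
      ((LinearMap.mul R H ∘ₗ antipode R) l).rTensor H t = (antipode R l ⊗ₜ 1) * t := by
    intro l t
    induction t with
    | zero => simp
    | add a b ha hb => simp only [map_add, mul_add, ha, hb]
    | tmul a b => simp
  have hc : ∀ b : H, comul (R := R) b * comul Λ = counit (R := R) b • comul Λ := fun b => by
    rw [← Bialgebra.comul_mul, hΛ b]
    simp
  rw [← sum_rTensor_comul _ lift_antipode_mul a, Finset.sum_mul]
  simp only [key, mul_assoc, hc]
  have h := congrArg (antipode R)
    (congrArg (TensorProduct.rid R H) (sum_tmul_counit_eq (ℛ R a)))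
  simp only [map_sum, TensorProduct.rid_tmul, one_smul, map_smul] at h
  conv_rhs => rw [← h, TensorProduct.sum_tmul, Finset.sum_mul]
  refine Finset.sum_congr rfl fun i _ => ?_
  rw [mul_smul_comm, ← TensorProduct.smul_tmul', smul_mul_assoc]

/-- The mirror argument, from `a ⊗ 1 = ∑ Δ(a₁) (1 ⊗ 𝒮(a₂))`. -/
theorem comul_mul_tmul_one {Λ : H} (hΛ : Λ ∈ rightIntegrals (Bialgebra.counitAlgHom R H)) (a : H) :
    comul Λ * (a ⊗ₜ[R] 1) = comul Λ * (1 ⊗ₜ[R] antipode R a) := by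
  have key : ∀ (l : H) (t : H ⊗[R] H),
      (((LinearMap.mul R H).compl₂ (antipode R)).flip l).lTensor H t =
        t * (1 ⊗ₜ antipode R l) := by
    intro l t
    induction t with
    | zero => simp
    | add a b ha hb => simp only [map_add, add_mul, ha, hb]
    | tmul a b => simp
  have hc : ∀ b : H, comul Λ * comul (R := R) b = counit (R := R) b • comul Λ := fun b => by
    rw [← Bialgebra.comul_mul, hΛ b]
    simp
  rw [← sum_lTensor_comul _ lift_mul_antipode a, Finset.mul_sum]
  simp only [key, ← mul_assoc, hc]
  have h := congrArg (antipode R) (sum_counit_smul (ℛ R a))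
  simp only [map_sum, map_smul] at h
  conv_rhs => rw [← h, TensorProduct.tmul_sum, Finset.mul_sum]
  refine Finset.sum_congr rfl fun i _ => ?_
  rw [TensorProduct.tmul_smul, smul_mul_assoc, mul_smul_comm]

/-- Applying `𝒮 ⊗ 1` to `one_tmul_mul_comul` reverses products in the first leg, so the left factor
`𝒮(a)` becomes a right factor `𝒮²(a) = a`. -/
theorem IsInvolutory.one_tmul_mul_casimir (hinv : IsInvolutory R H) {Λ : H}
    (hΛ : Λ ∈ leftIntegrals (Bialgebra.counitAlgHom R H)) (a : H) :
    (1 ⊗ₜ[R] a) * casimir R Λ = casimir R Λ * (a ⊗ₜ[R] 1) := by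
  have h := congrArg ((antipode R (A := H)).rTensor H) (one_tmul_mul_comul hΛ a)
  have key : ∀ t : H ⊗[R] H,
      (antipode R (A := H)).rTensor H ((1 ⊗ₜ a) * t) =
        (1 ⊗ₜ a) * (antipode R (A := H)).rTensor H t ∧
      (antipode R (A := H)).rTensor H ((antipode R a ⊗ₜ 1) * t) =
        (antipode R (A := H)).rTensor H t * (a ⊗ₜ 1) := by
    intro t
    induction t with
    | zero => simp
    | add a b ha hb => simp only [map_add, mul_add, add_mul, ha, hb, and_self]
    | tmul x y => simp [antipode_mul_antidistrib, hinv _]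
  rwa [(key _).1, (key _).2] at h

theorem IsInvolutory.casimir_mul_one_tmul (hinv : IsInvolutory R H) {Λ : H}
    (hΛ : Λ ∈ rightIntegrals (Bialgebra.counitAlgHom R H)) (a : H) :
    casimir R Λ * (1 ⊗ₜ[R] a) = (a ⊗ₜ[R] 1) * casimir R Λ := by
  have h := congrArg ((antipode R (A := H)).rTensor H) (comul_mul_tmul_one hΛ (antipode R a))
  rw [hinv] at h
  have key : ∀ t : H ⊗[R] H,
      (antipode R (A := H)).rTensor H (t * (1 ⊗ₜ a)) =
        (antipode R (A := H)).rTensor H t * (1 ⊗ₜ a) ∧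
      (antipode R (A := H)).rTensor H (t * (antipode R a ⊗ₜ 1)) =
        (a ⊗ₜ 1) * (antipode R (A := H)).rTensor H t := by
    intro t
    induction t with
    | zero => simp
    | add a b ha hb => simp only [map_add, mul_add, add_mul, ha, hb, and_self]
    | tmul x y => simp [antipode_mul_antidistrib, hinv _]
  rw [(key _).1, (key _).2] at h
  exact h.symm

end Casimir

/-! ### The regular character is an integral of the dual algebra -/

section RegularCharacter

open HopfAlgebra Coalgebra

variable {R : Type u} [CommRing R] {H : Type v} [Ring H] [HopfAlgebra R H]

/-- The operator `x ↦ ∑ g(x₁) x₂`. -/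
noncomputable def leftContraction : Module.Dual R H →ₗ[R] Module.End R H where
  toFun g := TensorProduct.lid R H ∘ₗ g.rTensor H ∘ₗ comul
  map_add' f g := by ext x; simp [LinearMap.rTensor_add]
  map_smul' r g := by ext x; simp [LinearMap.rTensor_smul]

/-- The operator `x ↦ ∑ g(x₂) x₁`. -/
noncomputable def rightContraction : Module.Dual R H →ₗ[R] Module.End R H where
  toFun g := TensorProduct.rid R H ∘ₗ g.lTensor H ∘ₗ comul
  map_add' f g := by ext x; simp [LinearMap.lTensor_add]
  map_smul' r g := by ext x; simp [LinearMap.lTensor_smul]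

theorem leftContraction_apply (g : Module.Dual R H) (x : H) :
    leftContraction g x = TensorProduct.lid R H (g.rTensor H (comul x)) := rfl

theorem rightContraction_apply (g : Module.Dual R H) (x : H) :
    rightContraction g x = TensorProduct.rid R H (g.lTensor H (comul x)) := rfl

theorem leftContraction_eq_sum (g : Module.Dual R H) (x : H) :
    leftContraction g x = ∑ i ∈ (ℛ R x).index, g ((ℛ R x).left i) • (ℛ R x).right i := by
  rw [leftContraction_apply]
  conv_lhs => rw [← (ℛ R x).eq]
  simp [map_sum]

theorem rightContraction_eq_sum (g : Module.Dual R H) (x : H) :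
    rightContraction g x = ∑ i ∈ (ℛ R x).index, g ((ℛ R x).right i) • (ℛ R x).left i := by
  rw [rightContraction_apply]
  conv_lhs => rw [← (ℛ R x).eq]
  simp [map_sum]

variable [Module.Finite R H] [Module.Projective R H]

/-- Multiplication by `∑ f(a₁) a₂` is a sum of operators `L' ρ(a) L` whose reversed products satisfy
`∑ L L' = f(1)`; cyclicity of the trace concludes. -/
theorem IsInvolutory.convMul_character (hinv : IsInvolutory R H) (f : Module.Dual R H) (a : H) :
    character R H H (leftContraction f a) = f 1 * character R H H a := by
  obtain ⟨s, hs⟩ := exists_dualBasis R H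
  -- Summing over the dual basis substitutes `k = x₁`: the first identity becomes `∑ f(a₁ x₂ 𝒮(x₁))
  -- a₂ x₃`, collapsing by `𝒮² = 1`; the second becomes `∑ f(x₁ 𝒮(x₂)) x₃`, collapsing by the
  -- antipode axiom.
  let q : H →ₗ[R] Module.Dual R H :=
    (LinearMap.llcomp R H H R f) ∘ₗ (LinearMap.mul R H).flip ∘ₗ antipode R
  have hq : ∀ k y, q k y = f (y * antipode R k) := fun k y => rfl
  let ρ : H →ₐ[R] Module.End R H := Algebra.lsmul R R H
  have hρ : ∀ x y, ρ x y = x * y := fun x y => rfl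
  have h1 : ∑ p ∈ s, leftContraction (q p.2) * (ρ a * leftContraction p.1) =
      ρ (leftContraction f a) := by
    ext x
    have e1 : ∀ k y, leftContraction (q k) (a * y) = TensorProduct.lid R H (f.rTensor H
        (comul a * (((LinearMap.mul R H).flip ∘ₗ antipode R) k).rTensor H (comul y))) := by
      intro k y
      have : ∀ t t' : H ⊗[R] H, (q k).rTensor H (t * t') =
          f.rTensor H (t * (((LinearMap.mul R H).flip ∘ₗ antipode R) k).rTensor H t') := by
        intro t t'
        induction t with
        | zero => simp
        | add x y hx hy => simp only [add_mul, map_add, hx, hy]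
        | tmul x y =>
          induction t' with
          | zero => simp
          | add u v hu hv => simp only [mul_add, map_add, hu, hv]
          | tmul u v => simp [hq, mul_assoc]
      rw [leftContraction_apply, Bialgebra.comul_mul, this]
    have e2 : ∀ k y, ∑ p ∈ s, p.1 k • leftContraction (q p.2) y = leftContraction (q k) y := by
      intro k y
      conv_rhs => rw [← hs k]
      simp [map_sum, LinearMap.sum_apply]
    have e3 : ∑ p ∈ s, leftContraction (q p.2) (a * leftContraction p.1 x) =
        ∑ i ∈ (ℛ R x).index, leftContraction (q ((ℛ R x).left i)) (a * (ℛ R x).right i) := by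
      simp only [leftContraction_eq_sum _ x, Finset.mul_sum, mul_smul_comm, map_sum, map_smul]
      rw [Finset.sum_comm]
      exact Finset.sum_congr rfl fun i _ => e2 _ _
    simp only [LinearMap.sum_apply, Module.End.mul_apply, hρ]
    rw [e3]
    simp only [e1]
    rw [← map_sum, ← map_sum, ← Finset.mul_sum,
      sum_rTensor_comul _ hinv.lift_mul_antipode_flip x, leftContraction_apply]
    induction comul (R := R) a with
    | zero => simp
    | add x y hx hy => simp only [add_mul, map_add, hx, hy]
    | tmul x y => simp
  have h2 : ∑ p ∈ s, leftContraction p.1 * leftContraction (q p.2) = f 1 • 1 := by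
    ext x
    have e1 : ∀ y z, ∑ p ∈ s, q p.2 y • leftContraction p.1 z = TensorProduct.lid R H (f.rTensor H
        (((LinearMap.mul R H).compl₂ (antipode R) y).rTensor H (comul z))) := by
      intro y z
      have : ∑ p ∈ s, q p.2 y • p.1 = f ∘ₗ (LinearMap.mul R H).compl₂ (antipode R) y := by
        ext k
        simp only [LinearMap.sum_apply, LinearMap.smul_apply, LinearMap.comp_apply,
          LinearMap.compl₂_apply, LinearMap.mul_apply', ← hq]
        conv_rhs => rw [← hs k]
        simp [map_sum, LinearMap.sum_apply, mul_comm]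
      rw [← LinearMap.comp_apply (LinearMap.rTensor H f), ← LinearMap.rTensor_comp, ← this,
        ← leftContraction_apply]
      simp [map_sum, LinearMap.sum_apply]
    simp only [LinearMap.sum_apply, Module.End.mul_apply]
    simp only [leftContraction_eq_sum (q _) x, map_sum, map_smul]
    rw [Finset.sum_comm]
    simp only [e1]
    rw [← map_sum, ← map_sum, sum_rTensor_comul _ lift_mul_antipode x]
    simp
  have hχ : ∀ b, character R H H b = trace R H (ρ b) := fun b => rfl
  rw [hχ, hχ, ← h1, map_sum]
  simp only [trace_mul_comm R H (leftContraction (q _)), mul_assoc]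
  rw [← map_sum, ← Finset.mul_sum, h2]
  simp

theorem IsInvolutory.character_convMul (hinv : IsInvolutory R H) (f : Module.Dual R H) (a : H) :
    character R H H (rightContraction f a) = f 1 * character R H H a := by
  obtain ⟨s, hs⟩ := exists_dualBasis R H
  -- The roles are exchanged: now `∑ f(a₂ x₂ 𝒮(x₃)) a₁ x₁` needs only the antipode axiom, while `∑
  -- f(x₃ 𝒮(x₂)) x₁` needs `𝒮² = 1`.
  let q : H →ₗ[R] Module.Dual R H :=
    (LinearMap.llcomp R H H R f) ∘ₗ (LinearMap.mul R H).flip ∘ₗ antipode R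
  have hq : ∀ k y, q k y = f (y * antipode R k) := fun k y => rfl
  let ρ : H →ₐ[R] Module.End R H := Algebra.lsmul R R H
  have hρ : ∀ x y, ρ x y = x * y := fun x y => rfl
  have h1 : ∑ p ∈ s, rightContraction (q p.2) * (ρ a * rightContraction p.1) =
      ρ (rightContraction f a) := by
    ext x
    have e1 : ∀ k y, rightContraction (q k) (a * y) = TensorProduct.rid R H (f.lTensor H
        (comul a * (((LinearMap.mul R H).compl₂ (antipode R)).flip k).lTensor H (comul y))) := by
      intro k y
      have : ∀ t t' : H ⊗[R] H, (q k).lTensor H (t * t') =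
          f.lTensor H (t * (((LinearMap.mul R H).compl₂ (antipode R)).flip k).lTensor H t') := by
        intro t t'
        induction t with
        | zero => simp
        | add x y hx hy => simp only [add_mul, map_add, hx, hy]
        | tmul x y =>
          induction t' with
          | zero => simp
          | add u v hu hv => simp only [mul_add, map_add, hu, hv]
          | tmul u v => simp [hq, mul_assoc]
      rw [rightContraction_apply, Bialgebra.comul_mul, this]
    have e2 : ∀ k y, ∑ p ∈ s, p.1 k • rightContraction (q p.2) y = rightContraction (q k) y := by
      intro k y
      conv_rhs => rw [← hs k]
      simp [map_sum, LinearMap.sum_apply]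
    have e3 : ∑ p ∈ s, rightContraction (q p.2) (a * rightContraction p.1 x) =
        ∑ i ∈ (ℛ R x).index, rightContraction (q ((ℛ R x).right i)) (a * (ℛ R x).left i) := by
      simp only [rightContraction_eq_sum _ x, Finset.mul_sum, mul_smul_comm, map_sum, map_smul]
      rw [Finset.sum_comm]
      exact Finset.sum_congr rfl fun i _ => e2 _ _
    simp only [LinearMap.sum_apply, Module.End.mul_apply, hρ]
    rw [e3]
    simp only [e1]
    rw [← map_sum, ← map_sum, ← Finset.mul_sum,
      sum_lTensor_comul _ lift_mul_antipode x, rightContraction_apply]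
    induction comul (R := R) a with
    | zero => simp
    | add x y hx hy => simp only [add_mul, map_add, hx, hy]
    | tmul x y => simp
  have h2 : ∑ p ∈ s, rightContraction p.1 * rightContraction (q p.2) = f 1 • 1 := by
    ext x
    have e1 : ∀ y z, ∑ p ∈ s, q p.2 y • rightContraction p.1 z =
        TensorProduct.rid R H (f.lTensor H
          ((((LinearMap.mul R H).flip ∘ₗ antipode R).flip y).lTensor H (comul z))) := by
      intro y z
      have : ∑ p ∈ s, q p.2 y • p.1 = f ∘ₗ ((LinearMap.mul R H).flip ∘ₗ antipode R).flip y := by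
        ext k
        simp only [LinearMap.sum_apply, LinearMap.smul_apply, LinearMap.comp_apply,
          LinearMap.flip_apply, LinearMap.mul_apply', ← hq]
        conv_rhs => rw [← hs k]
        simp [map_sum, LinearMap.sum_apply, mul_comm]
      rw [← LinearMap.comp_apply (LinearMap.lTensor H f), ← LinearMap.lTensor_comp, ← this,
        ← rightContraction_apply]
      simp [map_sum, LinearMap.sum_apply]
    simp only [LinearMap.sum_apply, Module.End.mul_apply]
    simp only [rightContraction_eq_sum (q _) x, map_sum, map_smul]
    rw [Finset.sum_comm]
    simp only [e1]
    rw [← map_sum, ← map_sum, sum_lTensor_comul _ hinv.lift_mul_antipode_flip x]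
    simp
  have hχ : ∀ b, character R H H b = trace R H (ρ b) := fun b => rfl
  rw [hχ, hχ, ← h1, map_sum]
  simp only [trace_mul_comm R H (rightContraction (q _)), mul_assoc]
  rw [← map_sum, ← Finset.mul_sum, h2]
  simp

theorem IsInvolutory.character_mem_integrals (hinv : IsInvolutory R H) :
    WithConv.toConv (character R H H) ∈ integrals (dualCounit R H) := by
  refine ⟨fun f => ?_, fun f => ?_⟩
  · ext a
    have h := hinv.convMul_character f.ofConv a
    rw [leftContraction_eq_sum, map_sum] at h
    simp only [map_smul, smul_eq_mul] at h
    rw [(ℛ R a).convMul_apply]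
    exact h
  · ext a
    have h := hinv.character_convMul f.ofConv a
    rw [rightContraction_eq_sum, map_sum] at h
    simp only [map_smul, smul_eq_mul] at h
    rw [(ℛ R a).convMul_apply]
    refine Eq.trans (Finset.sum_congr rfl fun i _ => mul_comm _ _) h

/-- Left multiplication by `Λ` is the rank-one operator `x ↦ ε(x) Λ`. -/
theorem character_rightIntegral {Λ : H}
    (hΛ : Λ ∈ rightIntegrals (Bialgebra.counitAlgHom R H)) :
    character R H H Λ = counit (R := R) Λ := by
  have h : (Algebra.lsmul R R H : H →ₐ[R] Module.End R H) Λ =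
      (counit (R := R) (A := H)).smulRight Λ := by
    ext x
    exact hΛ x
  change trace R H ((Algebra.lsmul R R H : H →ₐ[R] Module.End R H) Λ) = _
  rw [h, trace_smulRight]

end RegularCharacter

/-! ### Schur's lemma and invertibility of the rank -/

section Schur

variable {R : Type u} [CommRing R] {A : Type v} [Ring A] [Algebra R A]
  (M : Type w) [AddCommGroup M] [Module R M] [Module A M] [IsScalarTower R A M]

variable (R) in
/-- The operator `∑ y φ x` on `M` attached to `∑ x ⊗ y` and `φ`. -/
noncomputable def sandwich (φ : Module.End R M) : A ⊗[R] A →ₗ[R] Module.End R M :=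
  TensorProduct.lift (LinearMap.mk₂ R
    (fun x y => Algebra.lsmul R R M y * φ * Algebra.lsmul R R M x)
    (fun x x' y => by simp only [map_add, mul_add])
    (fun r x y => by simp only [map_smul, mul_smul_comm])
    (fun x y y' => by simp only [map_add, add_mul])
    (fun r x y => by simp only [map_smul, smul_mul_assoc]))

theorem sandwich_tmul (φ : Module.End R M) (x y : A) (m : M) :
    sandwich R M φ (x ⊗ₜ y) m = y • φ (x • m) := rfl

variable {M}

/-- The relation on `c` moves `a` through the operator, which is therefore `A`-linear, hence a
scalar. -/
theorem exists_sandwich_eq_smul (e : Module.End A M ≃ₐ[R] R) {c : A ⊗[R] A}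
    (hc : ∀ a : A, (1 ⊗ₜ a) * c = c * (a ⊗ₜ 1)) (φ : Module.End R M) :
    ∃ r : R, sandwich R M φ c = r • 1 := by
  have key : ∀ (a : A) (z : A ⊗[R] A) (m : M),
      sandwich R M φ ((1 ⊗ₜ a) * z) m = a • sandwich R M φ z m ∧
      sandwich R M φ (z * (a ⊗ₜ 1)) m = sandwich R M φ z (a • m) := by
    intro a z m
    induction z with
    | zero => simp
    | add x y hx hy => simp only [mul_add, add_mul, map_add, LinearMap.add_apply, smul_add, hx, hy,
        and_self]
    | tmul x y => simp [sandwich_tmul, mul_smul]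
  let T : Module.End A M :=
    { toFun := sandwich R M φ c
      map_add' := map_add _
      map_smul' := fun a m => by
        rw [RingHom.id_apply, ← (key a c m).1, ← (key a c m).2, hc] }
  refine ⟨e T, LinearMap.ext fun m => ?_⟩
  have h : T = algebraMap R _ (e T) := by
    apply e.injective
    rw [AlgEquiv.commutes]
    rfl
  exact LinearMap.congr_fun h m

theorem faithful_of_endEquiv (e : Module.End A M ≃ₐ[R] R) (r : R)
    (hr : ∀ m : M, r • m = 0) : r = 0 := by
  have h : algebraMap R (Module.End A M) r = 0 := LinearMap.ext hr
  have h' := congrArg e h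
  rwa [AlgEquiv.commutes, map_zero] at h'

variable (R A M) in
/-- The action of `A ⊗ A` on `M ⊗ M`. -/
noncomputable def tensorAction : A ⊗[R] A →ₐ[R] Module.End R (M ⊗[R] M) :=
  (Module.endTensorEndAlgHom (R := R) (A := R) (M := M) (N := M)).comp
    (Algebra.TensorProduct.map (Algebra.lsmul R R M) (Algebra.lsmul R R M))

theorem tensorAction_tmul (x y : A) (m n : M) :
    tensorAction R A M (x ⊗ₜ y) (m ⊗ₜ n) = (x • m) ⊗ₜ (y • n) := rfl

variable [Module.Finite R M] [Module.Projective R M]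

theorem trace_sandwich (φ : Module.End R M) (z : A ⊗[R] A) :
    trace R M (sandwich R M φ z) =
      trace R M (φ * Algebra.lsmul R R M (LinearMap.mul' R A z)) := by
  induction z with
  | zero => simp
  | add x y hx hy => simp only [map_add, mul_add, hx, hy]
  | tmul x y =>
    have : sandwich R M φ (x ⊗ₜ y) =
      Algebra.lsmul R R M y * (φ * Algebra.lsmul R R M x) := rfl
    rw [this, trace_mul_comm, mul_assoc, LinearMap.mul'_apply,
      map_mul (Algebra.lsmul R R M)]

/-- If the operator of `φ` is the scalar `s`, its trace gives `s * rank = r₀ * Tr(φ)`. A `φ` of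
trace 1 makes the rank a divisor of the unit `r₀`, after which `s` can be solved for in general. -/
theorem exists_rank_unit (e : Module.End A M ≃ₐ[R] R) {c : A ⊗[R] A}
    (hc : ∀ a : A, (1 ⊗ₜ a) * c = c * (a ⊗ₜ 1)) {r₀ : R}
    (hr₀ : LinearMap.mul' R A c = algebraMap R A r₀) (hu : IsUnit r₀) :
    ∃ r : Rˣ, (r : R) = rank R M ∧
    ∀ φ : Module.End R M, sandwich R M φ c = (r₀ * ((r⁻¹ : Rˣ) : R) * trace R M φ) • 1 := by
  have htr : ∀ (φ : Module.End R M) (s : R), sandwich R M φ c = s • 1 →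
      s * rank R M = r₀ * trace R M φ := by
    intro φ s hs
    have h := trace_sandwich φ c
    rw [hs, hr₀, map_smul, AlgHom.commutes, Algebra.algebraMap_eq_smul_one, mul_smul_comm,
      mul_one, map_smul] at h
    exact h
  obtain ⟨φ₀, hφ₀⟩ := exists_trace_eq_one M (faithful_of_endEquiv e)
  obtain ⟨s₀, hs₀⟩ := exists_sandwich_eq_smul e hc φ₀
  have h₀ := htr φ₀ s₀ hs₀
  rw [hφ₀, mul_one] at h₀
  obtain ⟨r, hr⟩ : IsUnit (rank R M) := isUnit_of_mul_isUnit_right (h₀ ▸ hu)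
  refine ⟨r, hr, fun φ => ?_⟩
  obtain ⟨s, hs⟩ := exists_sandwich_eq_smul e hc φ
  have h := htr φ s hs
  rw [← hr] at h
  rw [hs, mul_right_comm, ← h, Units.mul_inv_cancel_right]

end Schur

/-! ### Action of the Casimir element on `M` and on `M ⊗ M` -/

section Consequences

variable {R : Type u} [CommRing R] {A : Type v} [Ring A] [Algebra R A]
  {M : Type w} [AddCommGroup M] [Module R M] [Module A M] [IsScalarTower R A M]
  [Module.Finite R M] [Module.Projective R M]

/-- Expanding the character in a dual basis turns `χ(x) y m` into a sum of sandwiches of the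
rank-one maps `p.1.smulRight m`, whose traces `p.1 m` reassemble `m`. -/
theorem character_contraction_smul {c : A ⊗[R] A} {ω : R}
    (hω : ∀ φ : Module.End R M, sandwich R M φ c = (ω * trace R M φ) • 1) (m : M) :
    TensorProduct.lid R A ((character R A M).rTensor A c) • m = ω • m := by
  obtain ⟨s, hs⟩ := exists_dualBasis R M
  have key : ∀ z : A ⊗[R] A, TensorProduct.lid R A ((character R A M).rTensor A z) • m =
      ∑ p ∈ s, sandwich R M (p.1.smulRight m) z p.2 := by
    intro z
    induction z with
    | zero => simp
    | add x y hx hy =>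
      simp only [map_add, add_smul, LinearMap.add_apply, Finset.sum_add_distrib, hx, hy]
    | tmul x y =>
      have h : character R A M x = ∑ p ∈ s, p.1 (x • p.2) := trace_eq_sum hs _
      simp only [LinearMap.rTensor_tmul, TensorProduct.lid_tmul, h, sandwich_tmul,
        LinearMap.smulRight_apply, smul_comm y, smul_assoc, Finset.sum_smul]
  rw [key]
  simp only [hω, trace_smulRight, LinearMap.smul_apply, Module.End.one_apply, mul_smul]
  rw [← Finset.smul_sum, hs]

/-- The same rank-one sandwiches show that `c` acts as `ω` times the flip. -/
theorem tensorAction_casimir {c : A ⊗[R] A} {ω : R}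
    (hω : ∀ φ : Module.End R M, sandwich R M φ c = (ω * trace R M φ) • 1) (m n : M) :
    tensorAction R A M c (n ⊗ₜ m) = ω • (m ⊗ₜ n) := by
  obtain ⟨s, hs⟩ := exists_dualBasis R M
  have key : ∀ z : A ⊗[R] A, tensorAction R A M z (n ⊗ₜ m) =
      ∑ p ∈ s, p.2 ⊗ₜ[R] sandwich R M (p.1.smulRight m) z n := by
    intro z
    induction z with
    | zero => simp
    | add x y hx hy =>
      simp only [map_add, LinearMap.add_apply, TensorProduct.tmul_add, Finset.sum_add_distrib,
        hx, hy]
    | tmul x y =>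
      rw [tensorAction_tmul]
      conv_lhs => rw [← hs (x • n), TensorProduct.sum_tmul]
      refine Finset.sum_congr rfl fun p _ => ?_
      rw [sandwich_tmul, LinearMap.smulRight_apply, smul_comm y, TensorProduct.smul_tmul]
  rw [key]
  conv_rhs => rw [← hs m, TensorProduct.sum_tmul, Finset.smul_sum]
  refine Finset.sum_congr rfl fun p _ => ?_
  rw [hω, trace_smulRight, LinearMap.smul_apply, Module.End.one_apply, mul_smul,
    TensorProduct.tmul_smul, TensorProduct.tmul_smul, TensorProduct.smul_tmul']

theorem isIntegral_of_casimir {c : A ⊗[R] A} {ω : R}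
    (hω : ∀ φ : Module.End R M, sandwich R M φ c = (ω * trace R M φ) • 1) (hM : ∀ r : R, (∀ m : M, r • m = 0) → r = 0)
    (S : Subring R) (hint : IsIntegral S c) : IsIntegral S ω := by
  have h1 : IsIntegral S (tensorAction R A M c ^ 2) := (hint.map ((tensorAction R A M).restrictScalars S)).pow 2
  have h2 : tensorAction R A M c ^ 2 = algebraMap R _ (ω ^ 2) := by
    refine TensorProduct.ext' fun m n => ?_
    have h : ∀ m n, tensorAction R A M c (m ⊗ₜ n) = ω • (n ⊗ₜ m) := fun m n => tensorAction_casimir hω n m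
    rw [pow_two, Module.End.mul_apply, h, map_smul, h, smul_smul, ← pow_two]
    rfl
  rw [h2] at h1
  refine IsIntegral.of_pow two_pos ((isIntegral_algebraMap_iff ?_).mp h1)
  -- Integrality descends because `M ⊗ M` is faithful: if `r` kills it, then `r * p.1 m` kills `M`
  -- for each `p`, so `r` kills `m`.
  rw [injective_iff_map_eq_zero]
  intro r hr
  have h3 : ∀ m n : M, r • (m ⊗ₜ[R] n) = 0 := fun m n => LinearMap.congr_fun hr (m ⊗ₜ n)
  obtain ⟨s, hs⟩ := exists_dualBasis R M
  refine hM r fun m => ?_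
  rw [← hs m, Finset.smul_sum]
  refine Finset.sum_eq_zero fun p _ => ?_
  have h4 : r * p.1 m = 0 := hM _ fun n => by
    have h5 := congrArg ((TensorProduct.lid R M).toLinearMap ∘ₗ p.1.rTensor M) (h3 m n)
    simpa [smul_smul] using h5
  rw [smul_smul, h4, zero_smul]

end Consequences

/-! ### The Frobenius form and its dual bases -/

section FrobeniusForm

open HopfAlgebra Coalgebra

variable {R : Type u} [CommRing R] {H : Type v} [Ring H] [HopfAlgebra R H]

theorem isUnit_counit_of_separable (hsep : IsSeparableAlgebra R H) {Λ : H}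
    (hΛ : integrals (Bialgebra.counitAlgHom R H) = Submodule.span R {Λ}) :
    IsUnit (counit (R := R) Λ) := by
  obtain ⟨t, ht, ht1⟩ := hsep.exists_integral (Bialgebra.counitAlgHom R H)
  rw [hΛ] at ht
  obtain ⟨r, rfl⟩ := Submodule.mem_span_singleton.mp ht
  rw [map_smul, smul_eq_mul] at ht1
  exact IsUnit.of_mul_eq_one_right r ht1

/-- The map `x ⊗ y ↦ l(y) x`. -/
noncomputable def contractSnd (l : Module.Dual R H) : H ⊗[R] H →ₗ[R] H :=
  TensorProduct.rid R H ∘ₗ l.lTensor H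

theorem contractSnd_tmul (l : Module.Dual R H) (x y : H) :
    contractSnd l (x ⊗ₜ y) = l y • x := by
  simp [contractSnd]

theorem contractSnd_mul_tmul_one (l : Module.Dual R H) (t : H ⊗[R] H) (a : H) :
    contractSnd l (t * (a ⊗ₜ 1)) = contractSnd l t * a := by
  induction t with
  | zero => simp
  | add x y hx hy => simp only [add_mul, map_add, hx, hy]
  | tmul x y => simp [contractSnd_tmul]

theorem contractSnd_tmul_one_mul (l : Module.Dual R H) (t : H ⊗[R] H) (a : H) :
    contractSnd l ((a ⊗ₜ 1) * t) = a * contractSnd l t := by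
  induction t with
  | zero => simp
  | add x y hx hy => simp only [mul_add, map_add, hx, hy]
  | tmul x y => simp [contractSnd_tmul]

theorem contractSnd_mul_one_tmul {l g : Module.Dual R H} {b : H} (h : ∀ a, l (a * b) = g a)
    (t : H ⊗[R] H) : contractSnd l (t * (1 ⊗ₜ b)) = contractSnd g t := by
  induction t with
  | zero => simp
  | add x y hx hy => simp only [add_mul, map_add, hx, hy]
  | tmul x y => simp [contractSnd_tmul, h]

theorem apply_mul_contractFst (l g : Module.Dual R H) (a : H) (t : H ⊗[R] H) :
    l (a * TensorProduct.lid R H (g.rTensor H t)) = g (contractSnd l ((1 ⊗ₜ a) * t)) := by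
  induction t with
  | zero => simp
  | add x y hx hy => simp only [mul_add, map_add, hx, hy]
  | tmul x y => simp [contractSnd_tmul, mul_comm]

/-- A preimage of `c` lies in `B ⊗_S B`, a finite `S`-algebra, and is thus integral; the map to `H
⊗_R H` is an algebra map. -/
theorem IsWeakForm.isIntegral_casimir {Λ : H} {S : Subring R} {B : Subalgebra S H}
    (hB : IsWeakForm S Λ B) : IsIntegral S (casimir R Λ) := by
  obtain ⟨w, hw⟩ := hB.casimir_mem
  have := hB.finite
  have hint : IsIntegral S w := IsIntegral.of_finite S w
  have h := hint.map ((Algebra.TensorProduct.mapOfCompatibleSMul R S S H H).comp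
    (Algebra.TensorProduct.map B.val B.val))
  rw [casimir, ← hw]
  exact h

variable [Module.Finite R H] [Module.Projective R H]

/-- Testing against the functionals of a dual basis reduces this to `g * l = g(1) l` in `H^∨`. -/
theorem rightContraction_leftIntegral {l : DualAlgebra R H}
    (hl : l ∈ leftIntegrals (dualCounit R H)) (a : H) :
    rightContraction l.ofConv a = l.ofConv a • 1 := by
  obtain ⟨s, hs⟩ := exists_dualBasis R H
  rw [← hs (rightContraction l.ofConv a), ← hs (l.ofConv a • 1)]
  refine Finset.sum_congr rfl fun p _ => congrArg (· • p.2) ?_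
  have h := congrArg (fun f : DualAlgebra R H => f a) (hl (WithConv.toConv p.1))
  simp only [(ℛ R a).convMul_apply] at h
  rw [rightContraction_eq_sum, map_sum]
  simp only [map_smul, smul_eq_mul]
  refine (Finset.sum_congr rfl fun i _ => mul_comm _ _).trans (h.trans ?_)
  exact mul_comm _ _

theorem contractSnd_casimir {l : DualAlgebra R H}
    (hl : l ∈ leftIntegrals (dualCounit R H)) (Λ : H) :
    contractSnd l.ofConv (casimir R Λ) = l.ofConv Λ • 1 := by
  have key : ∀ t : H ⊗[R] H, contractSnd l.ofConv ((antipode R (A := H)).rTensor H t) =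
      antipode R (TensorProduct.rid R H (l.ofConv.lTensor H t)) := by
    intro t
    induction t with
    | zero => simp
    | add x y hx hy => simp only [map_add, hx, hy]
    | tmul x y => simp [contractSnd_tmul]
  rw [casimir, key, ← rightContraction_apply, rightContraction_leftIntegral hl, map_smul,
    antipode_one]

variable {Λ : H} {l : DualAlgebra R H}

/-- Surjectivity of `b ↦ β(·, b)`, with an explicit preimage: contracting the first leg of the
Casimir element with `g`. -/
theorem IsInvolutory.form_contractFst (hinv : IsInvolutory R H)
    (hΛ : Λ ∈ leftIntegrals (Bialgebra.counitAlgHom R H))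
    (hl : l ∈ leftIntegrals (dualCounit R H)) (hlΛ : l.ofConv Λ = 1)
    (g : Module.Dual R H) (a : H) :
    l.ofConv (a * TensorProduct.lid R H (g.rTensor H (casimir R Λ))) = g a := by
  rw [apply_mul_contractFst, hinv.one_tmul_mul_casimir hΛ, contractSnd_mul_tmul_one,
    contractSnd_casimir hl, hlΛ, one_smul, one_mul]

/-- Injectivity: the other Casimir relation recovers `b` from the functional `β(·, b)`. -/
theorem IsInvolutory.eq_contractSnd (hinv : IsInvolutory R H)
    (hΛ : Λ ∈ rightIntegrals (Bialgebra.counitAlgHom R H))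
    (hl : l ∈ leftIntegrals (dualCounit R H)) (hlΛ : l.ofConv Λ = 1)
    {g : Module.Dual R H} {b : H} (h : ∀ a, l.ofConv (a * b) = g a) :
    b = contractSnd g (casimir R Λ) := by
  rw [← contractSnd_mul_one_tmul h, hinv.casimir_mul_one_tmul hΛ, contractSnd_tmul_one_mul,
    contractSnd_casimir hl, hlΛ, one_smul, mul_one]

theorem IsInvolutory.bijective_flip_dualForm (hinv : IsInvolutory R H)
    (hΛ : Λ ∈ integrals (Bialgebra.counitAlgHom R H))
    (hl : l ∈ leftIntegrals (dualCounit R H)) (hlΛ : l.ofConv Λ = 1) :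
    Function.Bijective (dualForm l).flip := by
  refine ⟨(injective_iff_map_eq_zero _).mpr fun b hb => ?_, fun g => ⟨_, LinearMap.ext
    (hinv.form_contractFst hΛ.1 hl hlΛ g)⟩⟩
  rw [hinv.eq_contractSnd hΛ.2 hl hlΛ (g := 0) (LinearMap.congr_fun hb)]
  simp [contractSnd]

/-- Write `l' = l(· b)`. Recovering `b` contracts `c` with `l'`, which is itself a left integral, so
`b = l'(Λ) • 1 = 1`. -/
theorem IsInvolutory.leftIntegral_unique (hinv : IsInvolutory R H)
    (hΛ : Λ ∈ integrals (Bialgebra.counitAlgHom R H))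
    (hl : l ∈ leftIntegrals (dualCounit R H)) (hlΛ : l.ofConv Λ = 1) {l' : DualAlgebra R H}
    (hl' : l' ∈ leftIntegrals (dualCounit R H)) (hlΛ' : l'.ofConv Λ = 1) : l' = l := by
  have h := hinv.form_contractFst hΛ.1 hl hlΛ l'.ofConv
  have hb := hinv.eq_contractSnd hΛ.2 hl hlΛ h
  rw [contractSnd_casimir hl', hlΛ', one_smul] at hb
  rw [hb] at h
  ext a
  rw [← h, mul_one]

end FrobeniusForm

end HopfIndex

/-! ### Assembly of the theorem -/

open HopfIndex in
theorem mainTheorem7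
    {R : Type u} [CommRing R] {H : Type v} [Ring H] [HopfAlgebra R H]
    [Module.Finite R H] [Module.Projective R H]
    (hsep : HopfIndex.IsSeparableAlgebra R H) (hinv : HopfIndex.IsInvolutory R H)
    (Λ : H) (hΛ : HopfIndex.integrals (Bialgebra.counitAlgHom R H) = Submodule.span R {Λ})
    (S : Subring R) (hS : ∃ B : Subalgebra S H, HopfIndex.IsWeakForm S Λ B)
    (M : Type w) [AddCommGroup M] [Module R M] [Module H M] [IsScalarTower R H M]
    [Module.Finite R M] [Module.Projective R M]
    (e : Module.End H M ≃ₐ[R] R) :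
    ∃ l : HopfIndex.DualAlgebra R H,
      l ∈ HopfIndex.integrals (HopfIndex.dualCounit R H) ∧ l.ofConv Λ = 1 ∧
      (∀ l' ∈ HopfIndex.leftIntegrals (HopfIndex.dualCounit R H), l'.ofConv Λ = 1 → l' = l) ∧
      ∃ hβ : HopfIndex.IsSymmetrizing (HopfIndex.dualForm l),
      ∃ r : Rˣ, (r : R) = HopfIndex.rank R M ∧
        HopfIndex.index M hβ e = Coalgebra.counit (R := R) Λ * ((r⁻¹ : Rˣ) : R) ∧
        IsIntegral S (HopfIndex.index M hβ e) := by
  have hΛI : Λ ∈ integrals (Bialgebra.counitAlgHom R H) :=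
    hΛ ▸ Submodule.mem_span_singleton_self Λ
  have hu := isUnit_counit_of_separable hsep hΛ
  obtain ⟨u, hu'⟩ := id hu
  let l : DualAlgebra R H := ((u⁻¹ : Rˣ) : R) • WithConv.toConv (character R H H)
  have hl_apply : ∀ a, l.ofConv a = ((u⁻¹ : Rˣ) : R) * character R H H a := fun _ => rfl
  have hl : l ∈ integrals (dualCounit R H) :=
    Submodule.smul_mem _ _ hinv.character_mem_integrals
  have hlΛ : l.ofConv Λ = 1 := by
    rw [hl_apply, character_rightIntegral hΛI.2, ← hu', Units.inv_mul]
  have hβ : IsSymmetrizing (dualForm l) :=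
    { assoc := fun x y z => congrArg l.ofConv (mul_assoc x y z)
      symm := fun x y => by
        change l.ofConv (x * y) = l.ofConv (y * x)
        rw [hl_apply, hl_apply, character_mul_comm]
      nonsingular := hinv.bijective_flip_dualForm hΛI hl.1 hlΛ }
  obtain ⟨r, hr, hω⟩ := exists_rank_unit e (hinv.one_tmul_mul_casimir hΛI.1)
    (mul'_casimir (R := R) Λ) hu
  -- Identifies the central element as a contraction of the Casimir element, whose action on `M` is
  -- known to be `ω`.
  have hz : characterElement M hβ =
      TensorProduct.lid R H ((character R H M).rTensor H (casimir R Λ)) := by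
    refine hβ.nonsingular.1 (LinearMap.ext fun a => ?_)
    exact (form_characterElement M hβ a).trans
      (hinv.form_contractFst hΛI.1 hl.1 hlΛ _ a).symm
  have hindex : index M hβ e = Coalgebra.counit (R := R) Λ * ((r⁻¹ : Rˣ) : R) := by
    refine Eq.trans (congrArg e (LinearMap.ext fun m => ?_)) (e.commutes _)
    change characterElement M hβ • m = _
    rw [hz]
    exact character_contraction_smul hω m
  obtain ⟨B, hB⟩ := hS
  refine ⟨l, hl, hlΛ, fun l' hl' h' => hinv.leftIntegral_unique hΛI hl.1 hlΛ hl' h', hβ, r, hr,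
    hindex, ?_⟩
  rw [hindex]
  exact isIntegral_of_casimir hω (faithful_of_endEquiv e) S hB.isIntegral_casimir
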